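/- Let $V$ be a nonzero finite-dimensional vector space over a field $\mathbb{F}$, and let $\mathrm{St}(V) = \widetilde{H}_{\dim(V)-2}(T(V);\mathbb{Z})$ be the Steinberg module of $\mathrm{GL}(V)$, where $T(V)$ is the Tits building of $V$, i.e. the nerve of the set of proper nonzero linear subspaces of $V$ partially ordered by inclusion, and $\mathrm{GL}(V)$ acts through its action on subspaces. (When $\dim V = 1$ the building is empty and $\mathrm{St}(V) = \widetilde{H}_{-1}(\varnothing;\mathbb{Z}) = \mathbb{Z}$.) Let $k$ be a connected commutative ring, that is, a nonzero commutative ring whose only idempotents are $0$ and $1$. Then the $k[\mathrm{GL}(V)]$-module $k \otimes_{\mathbb{Z}} \mathrm{St}(V)$ is indecomposable: it is nonzero and it has no direct summand other than $0$ and itself. Moreover, every $k[\mathrm{GL}(V)]$-linear endomorphism of $k \otimes_{\mathbb{Z}} \mathrm{St}(V)$ is multiplication by a unique scalar $c \in k$. -/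

import Mathlib

open scoped TensorProduct MonoidAlgebra

noncomputable section

/-! ### Reduced homology of the nerve of a partially ordered set -/

namespace OrderComplex

variable {P Q R : Type*} [PartialOrder P] [PartialOrder Q] [PartialOrder R]

/-- The augmented simplicial chains of the nerve of `P`, indexed by the number `m` of vertices: the
free abelian group on the strict chains `x₀ < ⋯ < x_{m-1}` in `P`, i.e. on the nondegenerate
`(m-1)`-simplices of the nerve. For `m = 0` there is one (empty) chain, so this is `ℤ` placed in
homological degree `-1`. -/
abbrev Chains (P : Type*) [PartialOrder P] (m : ℕ) : Type _ := (Fin m ↪o P) →₀ ℤ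

/-- The boundary map, sending `x₀ < ⋯ < x_m` to the alternating sum over `i` of the chains obtained
by leaving out `x_i`. For `m = 0` this is the augmentation. -/
def boundary (P : Type*) [PartialOrder P] (m : ℕ) : Chains P (m + 1) →ₗ[ℤ] Chains P m :=
  Finsupp.lsum ℤ fun s => LinearMap.toSpanSingleton ℤ (Chains P m)
    (∑ i : Fin (m + 1), Finsupp.single ((Fin.succAboveOrderEmb i).trans s) ((-1 : ℤ) ^ (i : ℕ)))

/-- The boundary maps form a chain complex. -/
lemma boundary_comp_boundary (P : Type*) [PartialOrder P] (m : ℕ) :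
    boundary P m ∘ₗ boundary P (m + 1) = 0 := by
  ext s : 2
  simp only [boundary, LinearMap.comp_apply, Finsupp.lsingle_apply, Finsupp.lsum_single,
    LinearMap.toSpanSingleton_apply, one_smul, map_sum,
    LinearMap.zero_apply, Finsupp.smul_single, smul_eq_mul, LinearMap.zero_comp, Finset.smul_sum]
  rw [← Finset.sum_product']
  refine Finset.sum_ninvolution (fun x : Fin (m+2) × Fin (m+1) => (x.1.succAbove x.2, x.2.predAbove x.1)) ?_ ?_ ?_ ?_
  · rintro ⟨i, j⟩
    have : (Fin.succAboveOrderEmb j).trans ((Fin.succAboveOrderEmb i).trans s) = (Fin.succAboveOrderEmb (j.predAbove i)).trans ((Fin.succAboveOrderEmb (i.succAbove j)).trans s) := by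
      ext k
      simp [Fin.succAbove_succAbove_succAbove_predAbove]
    simp only [this]
    rw [← Finsupp.single_add]
    rw [show ((-1:ℤ) ^ (i:ℕ) * (-1)^(j:ℕ) + (-1)^((i.succAbove j : Fin _):ℕ) * (-1)^((j.predAbove i : Fin _):ℕ)) = 0 from ?_, Finsupp.single_zero]
    rcases lt_or_ge j.castSucc i with h | h
    · rw [Fin.succAbove_of_castSucc_lt _ _ h, Fin.predAbove_of_castSucc_lt _ _ h]
      have : (i:ℕ) = (i.pred (Fin.ne_zero_of_lt h) : Fin _) + 1 := by
        have := h; simp [Fin.lt_def] at this; simp; omega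
      rw [this]; simp; ring
    · rw [Fin.succAbove_of_le_castSucc _ _ h, Fin.predAbove_of_le_castSucc _ _ h]
      simp; ring
  · rintro ⟨i, j⟩ _ h
    exact Fin.succAbove_ne i j (congrArg Prod.fst h)
  · simp
  · rintro ⟨i, j⟩
    simp [Fin.succAbove_succAbove_predAbove, Fin.predAbove_predAbove_succAbove]

/-- The cycles; every element is a cycle in the lowest degree `m = 0`. -/
def cycles (P : Type*) [PartialOrder P] : (m : ℕ) → Submodule ℤ (Chains P m)
  | 0 => ⊤
  | m + 1 => LinearMap.ker (boundary P m)

/-- The boundaries. -/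
def boundaries (P : Type*) [PartialOrder P] (m : ℕ) : Submodule ℤ (Chains P m) :=
  LinearMap.range (boundary P m)

/-- The reduced integral homology of the nerve of `P` in degree `m - 1`: cycles modulo boundaries
in the augmented simplicial chain complex. -/
abbrev ReducedHomology (P : Type*) [PartialOrder P] (m : ℕ) : Type _ :=
  cycles P m ⧸ (boundaries P m).submoduleOf (cycles P m)

/-- The map on chains induced by an order embedding. -/
def chainsMap (f : P ↪o Q) (m : ℕ) : Chains P m →ₗ[ℤ] Chains Q m :=
  Finsupp.lmapDomain ℤ ℤ fun s => s.trans f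

lemma chainsMap_id (m : ℕ) : chainsMap (RelEmbedding.refl (α := P) (· ≤ ·)) m = LinearMap.id := by
  ext s : 2
  simp [chainsMap]

lemma chainsMap_trans (f : P ↪o Q) (g : Q ↪o R) (m : ℕ) :
    chainsMap (f.trans g) m = chainsMap g m ∘ₗ chainsMap f m := by
  ext s : 2
  simp [chainsMap]
  rfl

lemma boundary_comp_chainsMap (f : P ↪o Q) (m : ℕ) :
    boundary Q m ∘ₗ chainsMap f (m + 1) = chainsMap f m ∘ₗ boundary P m := by
  ext s : 2
  simp [chainsMap, boundary, Finsupp.mapDomain_single]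
  rfl

lemma chainsMap_mem_cycles (f : P ↪o Q) :
    ∀ (m : ℕ) (x : Chains P m), x ∈ cycles P m → chainsMap f m x ∈ cycles Q m
  | 0, _, _ => Submodule.mem_top
  | m + 1, x, hx => by
    have h := LinearMap.congr_fun (boundary_comp_chainsMap f m) x
    have hx' : boundary P m x = 0 := hx
    simp only [LinearMap.comp_apply, hx', map_zero] at h
    exact h

lemma chainsMap_mem_boundaries (f : P ↪o Q) (m : ℕ) (x : Chains P m) (hx : x ∈ boundaries P m) :
    chainsMap f m x ∈ boundaries Q m := by
  obtain ⟨y, rfl⟩ := hx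
  exact ⟨chainsMap f (m + 1) y, LinearMap.congr_fun (boundary_comp_chainsMap f m) y⟩

/-- The map on cycles induced by an order embedding. -/
def cyclesMap (f : P ↪o Q) (m : ℕ) : cycles P m →ₗ[ℤ] cycles Q m :=
  (chainsMap f m).restrict (chainsMap_mem_cycles f m)

/-- The map on reduced homology induced by an order embedding. -/
def reducedHomologyMap (f : P ↪o Q) (m : ℕ) : ReducedHomology P m →ₗ[ℤ] ReducedHomology Q m :=
  Submodule.mapQ _ _ (cyclesMap f m) fun x hx => chainsMap_mem_boundaries f m x.1 hx

lemma reducedHomologyMap_id (m : ℕ) :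
    reducedHomologyMap (RelEmbedding.refl (α := P) (· ≤ ·)) m = LinearMap.id := by
  ext x
  refine congrArg (Submodule.Quotient.mk (p := (boundaries P m).submoduleOf (cycles P m)))
    (Subtype.ext (LinearMap.congr_fun (chainsMap_id m) x.1))

lemma reducedHomologyMap_trans (f : P ↪o Q) (g : Q ↪o R) (m : ℕ) :
    reducedHomologyMap (f.trans g) m = reducedHomologyMap g m ∘ₗ reducedHomologyMap f m := by
  ext x
  refine congrArg (Submodule.Quotient.mk (p := (boundaries R m).submoduleOf (cycles R m)))
    (Subtype.ext (LinearMap.congr_fun (chainsMap_trans f g m) x.1))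

end OrderComplex

/-! ### The Tits building and the Steinberg module -/

section Steinberg

variable (F V : Type*) [Field F] [AddCommGroup V] [Module F V]

/-- The partially ordered set of proper nonzero linear subspaces of `V`, ordered by inclusion. -/
abbrev TitsBuilding : Type _ := {W : Submodule F V // W ≠ ⊥ ∧ W ≠ ⊤}

variable {F V} in
/-- The action of `g ∈ GL(V)` on the Tits building: `W ↦ g(W)`. -/
def TitsBuilding.map (g : LinearMap.GeneralLinearGroup F V) : TitsBuilding F V ↪o TitsBuilding F V :=
  let e := Submodule.orderIsoMapComap (LinearMap.GeneralLinearGroup.generalLinearEquiv F V g)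
  OrderEmbedding.ofMapLEIff
    (fun W => ⟨e W.1, fun h => W.2.1 ((map_eq_bot_iff e).1 h),
      fun h => W.2.2 ((map_eq_top_iff e).1 h)⟩)
    fun _ _ => e.le_iff_le

/-- The Steinberg module: the reduced integral homology of the Tits building in degree
`dim V - 2`, that is, on chains with `dim V - 1` vertices (`V` is meant to be nonzero). -/
abbrev SteinbergModule : Type _ :=
  OrderComplex.ReducedHomology (TitsBuilding F V) (Module.finrank F V - 1)

/-- The action of `GL(V)` on the Steinberg module, induced by that on the Tits building. -/
def steinbergRep :
    Representation ℤ (LinearMap.GeneralLinearGroup F V) (SteinbergModule F V) where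
  toFun g := OrderComplex.reducedHomologyMap (TitsBuilding.map g) _
  map_one' := by
    rw [show TitsBuilding.map (1 : LinearMap.GeneralLinearGroup F V) =
        RelEmbedding.refl (· ≤ ·) from ?_]
    · exact OrderComplex.reducedHomologyMap_id _
    · ext W x
      change x ∈ Submodule.map _ W.1 ↔ x ∈ W.1
      simp
  map_mul' g h := by
    rw [show TitsBuilding.map (g * h) = (TitsBuilding.map h).trans (TitsBuilding.map g) from ?_]
    · exact OrderComplex.reducedHomologyMap_trans _ _ _
    · ext W x
      change x ∈ Submodule.map _ W.1 ↔ x ∈ Submodule.map _ (Submodule.map _ W.1)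
      simp

/-- The representation `k ⊗ St(V)` of `GL(V)` over the commutative ring `k`, with `GL(V)` acting
through the second factor. -/
def steinbergRepBaseChange (k : Type*) [CommRing k] :
    Representation k (LinearMap.GeneralLinearGroup F V) (k ⊗[ℤ] SteinbergModule F V) :=
  (Module.End.baseChangeHom ℤ k (SteinbergModule F V)).toMonoidHom.comp (steinbergRep F V)

/-- The `k[GL(V)]`-module `k ⊗ St(V)`. -/
abbrev SteinbergGLModule (k : Type*) [CommRing k] : Type _ :=
  (steinbergRepBaseChange F V k).asModule

end Steinberg

/-- A module is indecomposable if it is nonzero and has no direct summand other than `0` and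
itself. -/
def IsIndecomposableModule (R M : Type*) [Ring R] [AddCommGroup M] [Module R M] : Prop :=
  Nontrivial M ∧ ∀ N N' : Submodule R M, IsCompl N N' → N = ⊥ ∨ N = ⊤

/-- A commutative ring is connected if it is nonzero and has no idempotents other than `0`
and `1`. -/
def IsConnectedRing (k : Type*) [CommRing k] : Prop :=
  Nontrivial k ∧ ∀ e : k, IsIdempotentElem e → e = 0 ∨ e = 1

end

/-! Chains longer than complete flags do not exist, so `St(V)` is the group of top cycles, and a
class has a coefficient at every complete flag. Fix a flag `C`. A top cycle is determined by its
coefficients at the flags opposite to `C` (`cycle_eq_zero`). An apartment through `C` contains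
exactly one flag opposite to `C`, with coefficient `±1` there. Hence the apartments through `C` span
the cycles (`span_apartment_eq_top`), and `retraction` splits the inclusion of cycles into chains.
The splitting survives tensoring with `k`, so elements of `k ⊗ St(V)` are still detected by their
coefficients (`eq_zero_of_homologyCoeff_eq_zero`).

Let `φ` be an equivariant endomorphism. The stabilizer of `C` permutes transitively the ordered
bases with flag `C`, and the coefficient at `C` is invariant under it. So the coefficient at `C` of
`φ(A)` is the same scalar `c` for every apartment `A` of such a basis, while that of `A` is `1`.
These apartments span, so "coefficient at `C`" composed with `φ` is `c` times "coefficient at `C`".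
Transitivity of `GL(V)` on flags carries this to every flag, and `φ = c`.

Projections onto direct summands are then idempotent scalars, hence `0` or `1` when `k` is
connected. -/

noncomputable section

namespace TitsBuilding

open Module

variable {F V : Type*} [Field F] [AddCommGroup V] [Module F V] {m : ℕ}

/-! ### Complete flags and bases -/

/-- The span of the first `k` vectors of a basis. -/
def spanLT (b : Basis (Fin (m + 1)) F V) (k : ℕ) : Submodule F V :=
  Submodule.span F (b '' {j | (j : ℕ) < k})

lemma mem_spanLT (b : Basis (Fin (m + 1)) F V) {k : ℕ} {x : V} :
    x ∈ spanLT b k ↔ ∀ j : Fin (m + 1), k ≤ j → b.repr x j = 0 := by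
  rw [spanLT, Basis.mem_span_image]
  constructor
  · intro h j hj
    by_contra hx
    exact absurd (h (Finsupp.mem_support_iff.2 hx)) (not_lt.2 hj)
  · intro h j hj
    by_contra hx
    exact Finsupp.mem_support_iff.1 hj (h j (not_lt.1 hx))

lemma basis_mem_spanLT (b : Basis (Fin (m + 1)) F V) {k : ℕ} {j : Fin (m + 1)} :
    b j ∈ spanLT b k ↔ (j : ℕ) < k := by
  constructor
  · intro h
    by_contra hj
    simpa using (mem_spanLT b).1 h j (not_lt.1 hj)
  · exact fun h => Submodule.subset_span ⟨j, h, rfl⟩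

lemma spanLT_mono (b : Basis (Fin (m + 1)) F V) : Monotone (spanLT b) := fun _ _ h =>
  Submodule.span_mono (Set.image_mono fun _ hj => lt_of_lt_of_le hj h)

lemma spanLT_eq_bot (b : Basis (Fin (m + 1)) F V) : spanLT b 0 = ⊥ := by
  simp [spanLT]

lemma spanLT_eq_top (b : Basis (Fin (m + 1)) F V) {k : ℕ} (hk : m + 1 ≤ k) : spanLT b k = ⊤ := by
  rw [eq_top_iff]
  intro x _
  exact (mem_spanLT b).2 fun j hj => absurd j.2 (by omega)

/-- The complete flag spanned by the initial segments of a basis. -/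
def flagOf (b : Basis (Fin (m + 1)) F V) : Fin m ↪o TitsBuilding F V :=
  OrderEmbedding.ofMapLEIff
    (fun i => ⟨spanLT b (i + 1), by
      constructor
      · intro h
        have : b 0 ∈ spanLT b (i + 1) := (basis_mem_spanLT b).2 (by simp)
        rw [h, Submodule.mem_bot] at this
        exact b.ne_zero 0 this
      · intro h
        have : b (Fin.last m) ∈ spanLT b (i + 1) := h ▸ Submodule.mem_top
        have := (basis_mem_spanLT b).1 this
        simp at this
        omega⟩)
    fun i j => by
      constructor
      · intro h
        have h1 : b i.castSucc ∈ spanLT b (j + 1) := h ((basis_mem_spanLT b).2 (by simp))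
        have := (basis_mem_spanLT b).1 h1
        simp at this
        exact Fin.le_def.2 (by omega)
      · intro h
        exact spanLT_mono b (Nat.succ_le_succ h)

@[simp] lemma flagOf_apply (b : Basis (Fin (m + 1)) F V) (i : Fin m) :
    (flagOf b i).1 = spanLT b (i + 1) := rfl

/-- A chain in the building, extended by `0` at the bottom and by `V` at the top. -/
def fullFlag (s : Fin m ↪o TitsBuilding F V) : ℕ → Submodule F V
  | 0 => ⊥
  | k + 1 => if h : k < m then (s ⟨k, h⟩).1 else ⊤

@[simp] lemma fullFlag_zero (s : Fin m ↪o TitsBuilding F V) : fullFlag s 0 = ⊥ := rfl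

lemma fullFlag_succ (s : Fin m ↪o TitsBuilding F V) (i : Fin m) :
    fullFlag s (i + 1) = (s i).1 := by simp [fullFlag]

lemma fullFlag_top (s : Fin m ↪o TitsBuilding F V) {k : ℕ} (hk : m + 1 ≤ k) :
    fullFlag s k = ⊤ := by
  obtain _ | k := k
  · omega
  · simp [fullFlag, show ¬ k < m by omega]

lemma fullFlag_congr {s t : Fin m ↪o TitsBuilding F V} {k : ℕ}
    (h : ∀ i : Fin m, (i : ℕ) + 1 = k → s i = t i) : fullFlag s k = fullFlag t k := by
  obtain _ | k := k
  · rfl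
  · by_cases hk : k < m
    · simp only [fullFlag, hk, dif_pos, h ⟨k, hk⟩ rfl]
    · simp only [fullFlag, hk, dif_neg, not_false_eq_true]

lemma fullFlag_mono (s : Fin m ↪o TitsBuilding F V) : Monotone (fullFlag s) := by
  refine monotone_nat_of_le_succ fun k => ?_
  obtain _ | k := k
  · simp
  · by_cases hk : k + 1 < m
    · simp only [fullFlag, hk, dif_pos, show k < m by omega]
      exact s.monotone (Fin.le_def.2 (Nat.le_succ k))
    · rw [fullFlag_top s (k := k + 1 + 1) (by omega)]
      exact le_top

lemma fullFlag_flagOf (b : Basis (Fin (m + 1)) F V) (k : ℕ) :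
    fullFlag (flagOf b) k = spanLT b k := by
  obtain _ | k := k
  · rw [spanLT_eq_bot, fullFlag_zero]
  · by_cases hk : k < m
    · exact fullFlag_succ (flagOf b) ⟨k, hk⟩
    · rw [spanLT_eq_top b (by omega), fullFlag_top _ (by omega)]

/-! ### Dimensions in a complete flag and the relative position of two flags. -/

section FiniteDimensional

variable [FiniteDimensional F V]

lemma finrank_chain_bounds (hn : finrank F V = m + 1) (W : TitsBuilding F V) :
    0 < finrank F W.1 ∧ finrank F W.1 < m + 1 := by
  refine ⟨?_, hn ▸ Submodule.finrank_lt W.2.2⟩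
  exact Submodule.one_le_finrank_iff.2 W.2.1

/-- There are no chains in the building longer than the complete flags. -/
lemma isEmpty_chains (hn : finrank F V = m + 1) : IsEmpty (Fin (m + 1) ↪o TitsBuilding F V) := by
  refine ⟨fun s => ?_⟩
  -- Dimensions strictly increase along a chain and take only the `m` values `1, …, m`.
  have hf : Function.Injective (fun i : Fin (m + 1) =>
      (⟨finrank F (s i).1 - 1, by have := finrank_chain_bounds hn (s i); omega⟩ : Fin m)) := by
    refine StrictMono.injective fun i j hij => ?_
    have h1 := finrank_chain_bounds hn (s i)
    have h2 : finrank F (s i).1 < finrank F (s j).1 :=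
      Submodule.finrank_lt_finrank_of_lt (s.strictMono hij)
    simp only [Fin.mk_lt_mk]
    omega
  simpa using Fintype.card_le_of_injective _ hf

lemma finrank_chain (hn : finrank F V = m + 1) (s : Fin m ↪o TitsBuilding F V) (i : Fin m) :
    finrank F (s i).1 = i + 1 := by
  set f : Fin m → Fin m := fun i =>
    ⟨finrank F (s i).1 - 1, by have := finrank_chain_bounds hn (s i); omega⟩ with hf
  have hmono : StrictMono f := by
    intro i j hij
    have h1 := finrank_chain_bounds hn (s i)
    have h2 : finrank F (s i).1 < finrank F (s j).1 :=
      Submodule.finrank_lt_finrank_of_lt (s.strictMono hij)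
    simp only [hf, Fin.mk_lt_mk]
    omega
  -- A strictly monotone self-map of `Fin m` is the identity.
  have h : (f i : ℕ) = i := congrArg Fin.val (le_antisymm hmono.apply_le hmono.le_apply)
  have h1 := finrank_chain_bounds hn (s i)
  simp only [hf] at h
  omega

lemma finrank_fullFlag (hn : finrank F V = m + 1) (s : Fin m ↪o TitsBuilding F V) {k : ℕ}
    (hk : k ≤ m + 1) : finrank F (fullFlag s k) = k := by
  obtain _ | k := k
  · rw [fullFlag_zero, finrank_bot]
  · by_cases h : k < m
    · rw [fullFlag_succ s ⟨k, h⟩, finrank_chain hn]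
    · rw [fullFlag_top s (by omega), finrank_top, hn]
      omega

lemma chain_ext_of_le (hn : finrank F V = m + 1) {s t : Fin m ↪o TitsBuilding F V}
    (h : ∀ i, (s i).1 ≤ (t i).1) : s = t := by
  ext1 i
  refine Subtype.ext (Submodule.eq_of_le_of_finrank_le (h i) ?_)
  rw [finrank_chain hn, finrank_chain hn]

lemma flagOf_eq (hn : finrank F V = m + 1) {b : Basis (Fin (m + 1)) F V}
    {s : Fin m ↪o TitsBuilding F V} (h : ∀ j : Fin (m + 1), b j ∈ fullFlag s (j + 1)) :
    flagOf b = s := by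
  refine chain_ext_of_le hn fun i => ?_
  rw [flagOf_apply, spanLT, Submodule.span_le]
  rintro _ ⟨j, hj, rfl⟩
  rw [← fullFlag_succ]
  exact fullFlag_mono s (Nat.succ_le_of_lt hj) (h j)

/-- Consecutive terms differ by one dimension, so any vector outside the smaller one generates the
larger one over it. -/
lemma fullFlag_le_sup (hn : finrank F V = m + 1) (s : Fin m ↪o TitsBuilding F V) {k : ℕ}
    {y : V} (hy : y ∈ fullFlag s (k + 1)) (hy' : y ∉ fullFlag s k) :
    fullFlag s (k + 1) ≤ fullFlag s k ⊔ Submodule.span F {y} := by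
  have hk : k + 1 ≤ m + 1 := by
    by_contra hk
    exact hy' (fullFlag_top s (k := k) (by omega) ▸ Submodule.mem_top)
  refine (Submodule.eq_of_le_of_finrank_le (sup_le (fullFlag_mono s k.le_succ) ?_) ?_).ge
  · rwa [Submodule.span_singleton_le_iff_mem]
  · rw [finrank_fullFlag hn s hk]
    nth_rw 1 [← finrank_fullFlag hn s (k := k) (by omega)]
    refine Submodule.finrank_lt_finrank_of_lt (lt_of_le_of_ne le_sup_left fun h => hy' ?_)
    rw [h]
    exact Submodule.mem_sup_right (Submodule.mem_span_singleton_self y)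

/-- Vectors chosen in the successive differences of a complete flag form a basis. -/
lemma exists_basis_of_mem (hn : finrank F V = m + 1) (s : Fin m ↪o TitsBuilding F V)
    (w : Fin (m + 1) → V) (hw : ∀ j : Fin (m + 1), w j ∈ fullFlag s (j + 1))
    (hw' : ∀ j : Fin (m + 1), w j ∉ fullFlag s j) :
    ∃ v : Basis (Fin (m + 1)) F V, ⇑v = w ∧ flagOf v = s := by
  have key : ∀ k ≤ m + 1, fullFlag s k ≤ Submodule.span F (Set.range w) := by
    intro k
    induction k with
    | zero => simp
    | succ k ih =>
      intro hk
      refine (fullFlag_le_sup hn s (hw ⟨k, hk⟩) (hw' ⟨k, hk⟩)).trans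
        (sup_le (ih (by omega)) (Submodule.span_mono ?_))
      simp
  have htop := key (m + 1) le_rfl
  rw [fullFlag_top s le_rfl] at htop
  refine ⟨basisOfTopLeSpanOfCardEqFinrank w htop (by simp [hn]), by simp, flagOf_eq hn ?_⟩
  simpa using hw

/-- Two complete flags have a common frame. -/
lemma exists_basis_flagOf_eq (hn : finrank F V = m + 1) (C s : Fin m ↪o TitsBuilding F V) :
    ∃ (v : Basis (Fin (m + 1)) F V) (σ : Equiv.Perm (Fin (m + 1))),
      flagOf v = C ∧ flagOf (v.reindex σ.symm) = s := by
  classical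
  have hex : ∀ i : Fin (m + 1), ∃ j, ¬ (fullFlag C (i + 1) ⊓ fullFlag s j ≤ fullFlag C i) := by
    intro i
    refine ⟨m + 1, fun h => ?_⟩
    rw [fullFlag_top s le_rfl, inf_top_eq] at h
    have := Submodule.finrank_mono h
    rw [finrank_fullFlag hn C (by omega), finrank_fullFlag hn C (by omega)] at this
    omega
  -- `β i` is the step of `s` at which the quotient `C_{i+1}/C_i` is first met. This is the
  -- Jordan–Hölder permutation of the two flags, shifted by one.
  set β : Fin (m + 1) → ℕ := fun i => Nat.find (hex i) with hβ
  have hβ1 : ∀ i : Fin (m + 1), ¬ (fullFlag C (i + 1) ⊓ fullFlag s (β i) ≤ fullFlag C i) :=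
    fun i => Nat.find_spec (hex i)
  have hβ2 : ∀ i j, j < β i → fullFlag C (i + 1) ⊓ fullFlag s j ≤ fullFlag C i :=
    fun i j hj => not_not.1 (Nat.find_min (hex i) hj)
  have hpos : ∀ i, 0 < β i := by
    intro i
    rw [Nat.pos_iff_ne_zero]
    intro h
    exact hβ1 i (by rw [h]; simp)
  have hle : ∀ i, β i ≤ m + 1 := by
    intro i
    by_contra h
    refine hβ1 i ?_
    rw [fullFlag_top s (k := β i) (by omega), ← fullFlag_top s (le_refl (m + 1))]
    exact hβ2 i _ (by omega)
  choose w hw hw' using fun i : Fin (m + 1) => SetLike.not_le_iff_exists.1 (hβ1 i)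
  obtain ⟨v, rfl, hv⟩ := exists_basis_of_mem hn C w (fun j => (hw j).1) hw'
  have hlt : ∀ i i', i < i' → β i ≠ β i' := by
    intro i i' hii h
    obtain ⟨j, hj⟩ : ∃ j, β i = j + 1 := ⟨β i - 1, by have := hpos i; omega⟩
    have hi := (hw i).2
    have hi' := (hw i').2
    rw [← h, hj] at hi'
    rw [hj] at hi
    have hnot : v i ∉ fullFlag s j := fun hmem => hw' i (hβ2 i j (by omega) ⟨(hw i).1, hmem⟩)
    -- If `β i = β i' = j + 1` with `i < i'`, subtracting a multiple of `v i` moves `v i'` into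
    -- `s_j`. By minimality of `β i'` the difference lies in `C_{i'}`, hence so does `v i'`, a
    -- contradiction.
    obtain ⟨d, hd, y, hy, hdy⟩ := Submodule.mem_sup.1 (fullFlag_le_sup hn s hi hnot hi')
    obtain ⟨t, rfl⟩ := Submodule.mem_span_singleton.1 hy
    have hiC : v i ∈ fullFlag C i' := fullFlag_mono C (Nat.succ_le_of_lt hii) (hw i).1
    have hdC : d ∈ fullFlag C i' := by
      refine hβ2 i' j (by omega) ⟨?_, hd⟩
      rw [eq_sub_of_add_eq hdy]
      exact Submodule.sub_mem _ (hw i').1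
        (Submodule.smul_mem _ _ (fullFlag_mono C (Nat.le_succ _) hiC))
    exact hw' i' (hdy ▸ Submodule.add_mem _ hdC (Submodule.smul_mem _ _ hiC))
  set f : Fin (m + 1) → Fin (m + 1) := fun i =>
    ⟨β i - 1, by have := hpos i; have := hle i; omega⟩ with hf
  have hinj : Function.Injective f := by
    intro i i' h
    have h1 : β i = β i' := by
      have := congrArg Fin.val h
      have := hpos i
      have := hpos i'
      simp only [hf] at *
      omega
    rcases lt_trichotomy i i' with h2 | h2 | h2
    · exact absurd h1 (hlt _ _ h2)
    · exact h2
    · exact absurd h1.symm (hlt _ _ h2)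
  let e : Equiv.Perm (Fin (m + 1)) := Equiv.ofBijective f (Finite.injective_iff_bijective.1 hinj)
  refine ⟨v, e.symm, hv, flagOf_eq hn fun j => ?_⟩
  obtain ⟨i, rfl⟩ := e.surjective j
  have he : ((e i : Fin (m + 1)) : ℕ) + 1 = β i := by
    have := hpos i
    change β i - 1 + 1 = β i
    omega
  rw [he]
  simpa using (hw i).2

lemma exists_flagOf_eq (hn : finrank F V = m + 1) (s : Fin m ↪o TitsBuilding F V) :
    ∃ v : Basis (Fin (m + 1)) F V, flagOf v = s :=
  let ⟨v, _, hv, _⟩ := exists_basis_flagOf_eq hn s s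
  ⟨v, hv⟩

end FiniteDimensional

open OrderComplex

/-! ### Permutations of the vectors of a basis -/

lemma perm_eq_one_of_apply_le {n : ℕ} {π : Equiv.Perm (Fin n)} (h : ∀ j, π j ≤ j) : π = 1 := by
  have key : ∀ j, π j = j := by
    intro j
    induction j using WellFoundedLT.induction with
    | ind j ih =>
      refine (h j).antisymm (not_lt.1 fun hlt => hlt.ne ?_)
      exact π.injective (ih _ hlt)
  exact Equiv.ext key

/-- Without an ascent `σ` is strictly decreasing, and the reversal is the only such permutation. -/
lemma exists_lt_succ_of_ne_revPerm {σ : Equiv.Perm (Fin (m + 1))} (h : σ ≠ Fin.revPerm) :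
    ∃ i : Fin m, σ i.castSucc < σ i.succ := by
  by_contra! hc
  have hanti : StrictAnti σ := Fin.strictAnti_iff_succ_lt.2 fun i =>
    lt_of_le_of_ne (hc i) fun h => (Fin.castSucc_lt_succ (i := i)).ne' (σ.injective h)
  have hmono : StrictMono fun i => (σ i).rev := fun _ _ hij => Fin.rev_lt_rev.2 (hanti hij)
  refine h (Equiv.ext fun i => ?_)
  have : (σ i).rev = i := le_antisymm hmono.apply_le hmono.le_apply
  rw [Fin.revPerm_apply, ← this, Fin.rev_rev, this]

/-- The basis `v (σ 0), …, v (σ m)`. -/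
abbrev permute (v : Basis (Fin (m + 1)) F V) (σ : Equiv.Perm (Fin (m + 1))) :
    Basis (Fin (m + 1)) F V := v.reindex σ.symm

lemma flagOf_permute_injective (v : Basis (Fin (m + 1)) F V) :
    Function.Injective fun σ => flagOf (permute v σ) := by
  intro σ τ h
  have h1 : ∀ j : Fin (m + 1), (τ⁻¹ * σ) j ≤ j := by
    intro j
    have h2 : permute v σ j ∈ spanLT (permute v σ) (j + 1) :=
      (basis_mem_spanLT _).2 (Nat.lt_succ_self _)
    rw [← fullFlag_flagOf, show flagOf (permute v σ) = _ from h, fullFlag_flagOf] at h2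
    have h3 : permute v σ j = permute v τ (τ⁻¹ (σ j)) := by simp
    rw [h3, basis_mem_spanLT] at h2
    exact Fin.le_def.2 (Nat.lt_succ_iff.1 h2)
  exact (inv_mul_eq_one.1 (perm_eq_one_of_apply_le h1)).symm

/-- The only flag in the apartment of `v` which can be opposite to the flag of `v` is the one
spanned by the final segments of `v`. -/
lemma eq_revPerm_of_flagOf_permute_eq {v v' : Basis (Fin (m + 1)) F V} (h : flagOf v = flagOf v')
    {σ : Equiv.Perm (Fin (m + 1))}
    (hσ : flagOf (permute v σ) = flagOf (permute v' Fin.revPerm)) : σ = Fin.revPerm := by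
  -- In `v'`-coordinates, `v (σ j)` is supported on indices at most `σ j` and also on indices at
  -- least `m - j`. Being nonzero, it forces `m - j ≤ σ j`.
  have h1 : ∀ j : Fin (m + 1), ((Fin.revPerm : Equiv.Perm (Fin (m + 1))) * σ) j ≤ j := by
    intro j
    have h2 : v (σ j) ∈ spanLT (permute v' Fin.revPerm) (j + 1) := by
      rw [← fullFlag_flagOf, ← hσ, fullFlag_flagOf]
      simpa using (basis_mem_spanLT (permute v σ)).2 (Nat.lt_succ_self j)
    have h3 : v (σ j) ∈ spanLT v' (σ j + 1) := by
      rw [← fullFlag_flagOf, ← h, fullFlag_flagOf]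
      exact (basis_mem_spanLT v).2 (Nat.lt_succ_self _)
    rw [mem_spanLT] at h2 h3
    by_contra hlt
    rw [not_le] at hlt
    refine v.ne_zero (σ j) (v'.ext_elem fun l => ?_)
    rw [map_zero, Finsupp.zero_apply]
    by_cases hl : (σ j : ℕ) + 1 ≤ l
    · exact h3 l hl
    · have h4 := h2 l.rev
      simp only [Basis.repr_reindex_apply, Equiv.symm_symm, Fin.revPerm_apply, Fin.rev_rev] at h4
      apply h4
      have := Fin.lt_def.1 hlt
      simp only [Equiv.Perm.mul_apply, Fin.revPerm_apply, Fin.val_rev] at this ⊢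
      omega
  have := perm_eq_one_of_apply_le h1
  rw [mul_eq_one_iff_eq_inv'] at this
  rw [this]
  rfl

/-- Exchanging two consecutive vectors of a basis changes only one subspace of its flag. -/
lemma spanLT_permute_swap (v : Basis (Fin (m + 1)) F V) (σ : Equiv.Perm (Fin (m + 1)))
    (i : Fin m) {k : ℕ} (hk : k ≠ i + 1) :
    spanLT (permute v (σ * Equiv.swap i.castSucc i.succ)) k = spanLT (permute v σ) k := by
  have key : ∀ l : Fin (m + 1), k ≤ l → k ≤ (Equiv.swap i.castSucc i.succ l : Fin (m + 1)) := by
    intro l hl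
    rw [Equiv.swap_apply_def]
    split_ifs with h1 h2
    · subst h1; simp at hl ⊢; omega
    · subst h2; simp at hl ⊢; omega
    · exact hl
  ext x
  simp only [mem_spanLT, Basis.repr_reindex_apply, Equiv.symm_symm, Equiv.Perm.mul_apply]
  constructor
  · intro h l hl
    simpa using h _ (key l hl)
  · exact fun h l hl => h _ (key l hl)

/-! ### Top cycles in the building -/

section Cycles

variable [FiniteDimensional F V]

/-- The dimensions present in a face of a complete flag reveal which one was removed. -/
lemma face_injective (hn : finrank F V = m + 2) {s t : Fin (m + 1) ↪o TitsBuilding F V}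
    {i j : Fin (m + 1)}
    (h : (Fin.succAboveOrderEmb i).trans s = (Fin.succAboveOrderEmb j).trans t) : i = j := by
  refine Fin.succAbove_left_injective (funext fun k => ?_)
  have h1 : s (i.succAbove k) = t (j.succAbove k) := DFunLike.congr_fun h k
  have h2 := finrank_chain (m := m + 1) hn s (i.succAbove k)
  have h3 := finrank_chain (m := m + 1) hn t (j.succAbove k)
  rw [h1] at h2
  exact Fin.ext (by omega)

/-- The cycle condition in the panel obtained by removing the `i`-th subspace of `s`. -/
lemma cycle_apply_eq_zero (hn : finrank F V = m + 1) {z : Chains (TitsBuilding F V) m}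
    (hz : z ∈ cycles (TitsBuilding F V) m) (s : Fin m ↪o TitsBuilding F V) (i : Fin m)
    (h : ∀ s' : Fin m ↪o TitsBuilding F V, s' ≠ s → (∀ j, j ≠ i → s' j = s j) → z s' = 0) :
    z s = 0 := by
  classical
  obtain _ | m := m
  · exact i.elim0
  have hz' : boundary (TitsBuilding F V) m z = 0 := hz
  -- The coefficient of the boundary at this face is, up to sign, the sum of `z` over all flags
  -- containing the face. Only the term of `s` survives.
  have h1 := DFunLike.congr_fun hz' ((Fin.succAboveOrderEmb i).trans s)
  rw [boundary, Finsupp.lsum_apply, Finsupp.sum, Finsupp.finsetSum_apply,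
    Finset.sum_eq_single s] at h1
  · simp only [LinearMap.toSpanSingleton_apply, Finsupp.smul_apply, Finsupp.finsetSum_apply] at h1
    rw [Finset.sum_eq_single i] at h1
    · simpa using h1
    · intro j _ hj
      exact Finsupp.single_eq_of_ne fun h2 => hj (face_injective hn h2.symm)
    · simp
  · intro s' _ hs'
    simp only [LinearMap.toSpanSingleton_apply, Finsupp.smul_apply, Finsupp.finsetSum_apply,
      smul_eq_mul]
    by_cases hf : (Fin.succAboveOrderEmb i).trans s' = (Fin.succAboveOrderEmb i).trans s
    · rw [h s' hs' ?_, zero_mul]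
      intro j hj
      obtain ⟨k, rfl⟩ := Fin.exists_succAbove_eq hj
      exact DFunLike.congr_fun hf k
    · rw [Finset.sum_eq_zero, mul_zero]
      intro j _
      refine Finsupp.single_eq_of_ne fun h2 => hf ?_
      obtain rfl := face_injective hn h2
      exact h2.symm
  · intro hs
    simp [Finsupp.notMem_support_iff.1 hs]

/-- The chambers in the panel of `flagOf (permute v σ)` of type `i`, if `σ i < σ (i + 1)`. -/
lemma exists_basis_of_adjacent (hn : finrank F V = m + 1) (v : Basis (Fin (m + 1)) F V)
    (σ : Equiv.Perm (Fin (m + 1))) (i : Fin m) (hi : σ i.castSucc < σ i.succ)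
    (s : Fin m ↪o TitsBuilding F V) (hs : s ≠ flagOf (permute v σ))
    (hsi : ∀ j, j ≠ i → s j = flagOf (permute v σ) j) :
    ∃ v' : Basis (Fin (m + 1)) F V, flagOf v' = flagOf v ∧
      flagOf (permute v' (σ * Equiv.swap i.castSucc i.succ)) = s := by
  classical
  set b := permute v σ with hb
  have hfull : ∀ k : ℕ, k ≠ i + 1 → fullFlag s k = spanLT b k := by
    intro k hk
    rw [← fullFlag_flagOf]
    exact fullFlag_congr fun j hj => hsi j fun h => hk (by rw [← hj, h])
  have hle : ¬ (s i).1 ≤ (flagOf b i).1 := by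
    intro hle
    refine hs (chain_ext_of_le hn fun j => ?_)
    by_cases hj : j = i
    · rwa [hj]
    · rw [hsi j hj]
  obtain ⟨x, hx, hx'⟩ := SetLike.not_le_iff_exists.1 hle
  have hx2 : x ∈ spanLT b (i + 2) := by
    rw [← hfull _ (by omega)]
    refine fullFlag_mono s (Nat.le_succ (i + 1)) ?_
    rwa [fullFlag_succ]
  have hr : b.repr x i.succ ≠ 0 := by
    intro h0
    refine hx' ((mem_spanLT b).2 fun j hj => ?_)
    by_cases hj' : j = i.succ
    · rw [hj', h0]
    · refine (mem_spanLT b).1 hx2 j ?_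
      have : (j : ℕ) ≠ i + 1 := fun h => hj' (Fin.ext h)
      omega
  set r := b.repr x i.succ with hrdef
  -- Modulo the preceding term of the flag, `r⁻¹ • x` is `b i.succ + t • b i.castSucc`, so this
  -- vector can replace `x`.
  set t := r⁻¹ * b.repr x i.castSucc with htdef
  have hne : i.castSucc ≠ i.succ := (Fin.castSucc_lt_succ (i := i)).ne
  have hmem : b i.succ + t • b i.castSucc ∈ (s i).1 := by
    have h1 : r⁻¹ • x - (b i.succ + t • b i.castSucc) ∈ fullFlag s i := by
      rw [hfull _ (by omega), mem_spanLT]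
      intro j hj
      simp only [map_sub, map_add, map_smul, Basis.repr_self, Finsupp.sub_apply,
        Finsupp.add_apply, Finsupp.smul_apply, smul_eq_mul]
      by_cases hj1 : j = i.castSucc
      · subst hj1
        simp [hne.symm, htdef]
      · by_cases hj2 : j = i.succ
        · subst hj2
          simp [hne, ← hrdef, hr]
        · rw [Finsupp.single_eq_of_ne hj2, Finsupp.single_eq_of_ne hj1,
            (mem_spanLT b).1 hx2 j ?_]
          · simp
          · have h1 : (j : ℕ) ≠ i := fun h => hj1 (Fin.ext h)
            have h2 : (j : ℕ) ≠ i + 1 := fun h => hj2 (Fin.ext h)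
            omega
    have h2 := fullFlag_mono s (Nat.le_succ i) h1
    rw [Nat.succ_eq_add_one, fullFlag_succ] at h2
    have h3 := Submodule.sub_mem _ ((s i).1.smul_mem r⁻¹ hx) h2
    rwa [sub_sub_cancel] at h3
  have hbi : b i.castSucc = v (σ i.castSucc) := by simp [hb]
  have hbs : b i.succ = v (σ i.succ) := by simp [hb]
  -- Since `σ i < σ (i + 1)`, the added multiple of `v (σ i)` comes from an earlier vector of `v`,
  -- so the flag of `v` does not change.
  obtain ⟨v', hv', hflag⟩ := exists_basis_of_mem hn (flagOf v)
    (Function.update v (σ i.succ) (b i.succ + t • b i.castSucc))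
    (by
      intro j
      rw [fullFlag_flagOf]
      by_cases hj : j = σ i.succ
      · rw [hj, Function.update_self, hbi, hbs]
        exact Submodule.add_mem _ ((basis_mem_spanLT v).2 (Nat.lt_succ_self _))
          (Submodule.smul_mem _ _ ((basis_mem_spanLT v).2 (Nat.lt_succ_of_lt hi)))
      · rw [Function.update_of_ne hj]
        exact (basis_mem_spanLT v).2 (Nat.lt_succ_self _))
    (by
      intro j
      rw [fullFlag_flagOf]
      by_cases hj : j = σ i.succ
      · rw [hj, Function.update_self, hbi, hbs]
        intro hmem
        have h1 := Submodule.sub_mem _ hmem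
          (Submodule.smul_mem _ t ((basis_mem_spanLT v).2 (Fin.lt_def.1 hi)))
        rw [add_sub_cancel_right, basis_mem_spanLT] at h1
        exact lt_irrefl _ h1
      · rw [Function.update_of_ne hj, basis_mem_spanLT]
        exact lt_irrefl _)
  refine ⟨v', hflag, flagOf_eq hn fun j => ?_⟩
  simp only [Basis.reindex_apply, Equiv.symm_symm, Equiv.Perm.mul_apply, hv']
  by_cases hj1 : j = i.castSucc
  · rw [hj1, Equiv.swap_apply_left, Function.update_self, Fin.val_castSucc, fullFlag_succ]
    exact hmem
  · by_cases hj2 : j = i.succ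
    · rw [hj2, Equiv.swap_apply_right, Function.update_of_ne (σ.injective.ne hne), ← hbi,
        hfull _ (by simp)]
      exact (basis_mem_spanLT b).2 (by simp)
    · rw [Equiv.swap_apply_of_ne_of_ne hj1 hj2, Function.update_of_ne (σ.injective.ne hj2),
        hfull _ fun h => hj1 (Fin.ext (by simpa using h))]
      simpa [hb] using (basis_mem_spanLT b).2 (Nat.lt_succ_self j)

/-- A top cycle which vanishes on the flags opposite to a given flag is zero. -/
lemma cycle_eq_zero (hn : finrank F V = m + 1) (C : Fin m ↪o TitsBuilding F V)
    {z : Chains (TitsBuilding F V) m} (hz : z ∈ cycles (TitsBuilding F V) m)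
    (h : ∀ v : Basis (Fin (m + 1)) F V, flagOf v = C → z (flagOf (permute v Fin.revPerm)) = 0) :
    z = 0 := by
  -- Downward lexicographic induction on the relative position `σ`, for all bases of `C` at once. At
  -- an ascent of `σ`, every other flag in the panel has position `σ * swap`, which is
  -- lexicographically larger, so the cycle condition gives vanishing at `σ`.
  have key : ∀ (x : Lex (Fin (m + 1) → Fin (m + 1))) (σ : Equiv.Perm (Fin (m + 1))),
      toLex ⇑σ = x → ∀ v : Basis (Fin (m + 1)) F V, flagOf v = C →
        z (flagOf (permute v σ)) = 0 := by
    intro x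
    induction x using WellFoundedGT.induction with
    | ind x ih =>
      rintro σ rfl v hv
      by_cases hσ : σ = Fin.revPerm
      · exact hσ ▸ h v hv
      obtain ⟨i, hi⟩ := exists_lt_succ_of_ne_revPerm hσ
      refine cycle_apply_eq_zero hn hz _ i fun s hs hsi => ?_
      obtain ⟨v', hv', rfl⟩ := exists_basis_of_adjacent hn v σ i hi s hs hsi
      refine ih _ ?_ _ rfl v' (hv'.trans hv)
      refine ⟨i.castSucc, fun j hj => ?_, ?_⟩
      · have h1 : j ≠ i.castSucc := hj.ne
        have h2 : j ≠ i.succ := (hj.trans (Fin.castSucc_lt_succ (i := i))).ne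
        simp [Equiv.swap_apply_of_ne_of_ne h1 h2]
      · simpa using hi
  ext s
  obtain ⟨v, σ, hv, rfl⟩ := exists_basis_flagOf_eq hn C s
  exact key _ σ rfl v hv

end Cycles

/-! ### Apartments -/

/-- The fundamental cycle of the apartment of a basis. -/
def apartment (v : Basis (Fin (m + 1)) F V) : Chains (TitsBuilding F V) m :=
  ∑ σ : Equiv.Perm (Fin (m + 1)),
    Finsupp.single (flagOf (permute v σ)) ((Equiv.Perm.sign σ : ℤˣ) : ℤ)

lemma apartment_mem_cycles (v : Basis (Fin (m + 1)) F V) :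
    apartment v ∈ cycles (TitsBuilding F V) m := by
  obtain _ | m := m
  · exact Submodule.mem_top
  change boundary (TitsBuilding F V) m (apartment v) = 0
  simp only [apartment, map_sum, boundary, Finsupp.lsum_single, LinearMap.toSpanSingleton_apply,
    Finset.smul_sum]
  rw [Finset.sum_comm]
  refine Finset.sum_eq_zero fun i _ => ?_
  -- The flags of `σ` and `σ * swap` share the face omitting index `i` and have opposite signs.
  refine Finset.sum_involution (fun σ _ => σ * Equiv.swap i.castSucc i.succ) ?_ ?_ ?_ ?_
  · intro σ _
    have h : (Fin.succAboveOrderEmb i).trans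
          (flagOf (permute v (σ * Equiv.swap i.castSucc i.succ))) =
        (Fin.succAboveOrderEmb i).trans (flagOf (permute v σ)) := by
      ext1 k
      refine Subtype.ext (spanLT_permute_swap v σ i fun h => ?_)
      exact Fin.succAbove_ne i k (Fin.ext (Nat.succ_injective h))
    rw [h, Equiv.Perm.sign_mul, Equiv.Perm.sign_swap (Fin.castSucc_lt_succ (i := i)).ne]
    simp
  · intro σ _ _ h
    have h1 := Equiv.congr_fun (mul_eq_left.1 h) i.castSucc
    rw [Equiv.swap_apply_left] at h1
    exact (Fin.castSucc_lt_succ (i := i)).ne' h1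
  · simp
  · intro σ _
    simp [mul_assoc]

lemma apartment_apply (v : Basis (Fin (m + 1)) F V) {s : Fin m ↪o TitsBuilding F V}
    (τ : Equiv.Perm (Fin (m + 1))) (h : ∀ σ, flagOf (permute v σ) = s → σ = τ)
    [Decidable (flagOf (permute v τ) = s)] :
    apartment v s = if flagOf (permute v τ) = s then ((Equiv.Perm.sign τ : ℤˣ) : ℤ) else 0 := by
  classical
  rw [apartment, Finsupp.finsetSum_apply, Finset.sum_eq_single τ]
  · rw [Finsupp.single_apply]
  · intro σ _ hσ
    exact Finsupp.single_eq_of_ne fun h' => hσ (h σ h'.symm)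
  · simp

lemma apartment_apply_flagOf (v : Basis (Fin (m + 1)) F V) : apartment v (flagOf v) = 1 := by
  classical
  have h1 : flagOf (permute v 1) = flagOf v := congrArg flagOf (v.reindex_refl)
  rw [apartment_apply v 1 fun σ h => flagOf_permute_injective v (h.trans h1.symm), if_pos h1]
  simp

lemma apartment_apply_opposite {v v' : Basis (Fin (m + 1)) F V} (h : flagOf v = flagOf v')
    [Decidable (flagOf (permute v Fin.revPerm) = flagOf (permute v' Fin.revPerm))] :
    apartment v (flagOf (permute v' Fin.revPerm)) =
      if flagOf (permute v Fin.revPerm) = flagOf (permute v' Fin.revPerm) then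
        ((Equiv.Perm.sign (Fin.revPerm (n := m + 1)) : ℤˣ) : ℤ) else 0 :=
  apartment_apply v Fin.revPerm fun _ h' => eq_revPerm_of_flagOf_permute_eq h h'

lemma map_flagOf (g : LinearMap.GeneralLinearGroup F V) (v : Basis (Fin (m + 1)) F V) :
    (flagOf v).trans (TitsBuilding.map g) =
      flagOf (v.map (LinearMap.GeneralLinearGroup.generalLinearEquiv F V g)) := by
  ext1 i
  refine Subtype.ext ?_
  change Submodule.map _ (Submodule.span F _) = Submodule.span F _
  rw [Submodule.map_span, Set.image_image]
  exact congrArg _ (Set.image_congr fun j _ => (Basis.map_apply _ _ _).symm)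

lemma chainsMap_apartment (g : LinearMap.GeneralLinearGroup F V) (v : Basis (Fin (m + 1)) F V) :
    chainsMap (TitsBuilding.map g) m (apartment v) =
      apartment (v.map (LinearMap.GeneralLinearGroup.generalLinearEquiv F V g)) := by
  simp only [apartment, map_sum, chainsMap, Finsupp.lmapDomain_apply, Finsupp.mapDomain_single]
  refine Finset.sum_congr rfl fun σ _ => congrArg (Finsupp.single · _) ?_
  rw [map_flagOf]
  exact congrArg flagOf (Basis.eq_of_apply_eq fun i => by simp)


/-! ### Projection of chains onto top cycles. -/

section Retraction

open scoped Classical in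
/-- The map sending each flag opposite to `C` to the signed apartment spanned by both flags, and
all other flags to zero. -/
def retraction (C : Fin m ↪o TitsBuilding F V) :
    Chains (TitsBuilding F V) m →ₗ[ℤ] cycles (TitsBuilding F V) m :=
  Finsupp.lsum ℤ fun s => LinearMap.toSpanSingleton ℤ _
    (if h : ∃ v : Basis (Fin (m + 1)) F V, flagOf v = C ∧ flagOf (permute v Fin.revPerm) = s then
      ((Equiv.Perm.sign (Fin.revPerm (n := m + 1)) : ℤˣ) : ℤ) •
        ⟨apartment h.choose, apartment_mem_cycles h.choose⟩
    else 0)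

lemma retraction_apply_of_mem_cycles [FiniteDimensional F V] (hn : finrank F V = m + 1)
    (C : Fin m ↪o TitsBuilding F V)
    (z : cycles (TitsBuilding F V) m) : retraction C z.1 = z := by
  classical
  rw [← sub_eq_zero]
  refine Subtype.ext (cycle_eq_zero hn C (Subtype.prop _) fun v hv => ?_)
  rw [Submodule.coe_sub, Finsupp.sub_apply, sub_eq_zero]
  -- At flags opposite to `C`, the coefficients of `retraction C z` and `z` agree for every chain
  -- `z`, so linearity reduces to a single flag.
  generalize z.1 = z
  induction z using Finsupp.induction_linear with
  | zero => simp
  | add z z' h h' => simp [h, h']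
  | single s a =>
    simp only [retraction, Finsupp.lsum_single, LinearMap.toSpanSingleton_apply]
    split_ifs with h
    · have hs := h.choose_spec
      simp only [Submodule.coe_smul, Finsupp.smul_apply, smul_eq_mul]
      rw [apartment_apply_opposite (hs.1.trans hv.symm), hs.2, Finsupp.single_apply]
      -- The sign in `retraction` cancels the sign of the apartment at the opposite flag.
      split_ifs <;> simp [← Units.val_mul]
    · rw [smul_zero, Finsupp.single_eq_of_ne]
      · rfl
      · rintro rfl
        exact h ⟨v, hv, rfl⟩

lemma retraction_mem_span (C : Fin m ↪o TitsBuilding F V) (z : Chains (TitsBuilding F V) m) :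
    retraction C z ∈ Submodule.span ℤ
      (Set.range fun v : {v : Basis (Fin (m + 1)) F V // flagOf v = C} =>
        (⟨apartment v.1, apartment_mem_cycles v.1⟩ : cycles (TitsBuilding F V) m)) := by
  classical
  induction z using Finsupp.induction_linear with
  | zero => simp
  | add z z' h h' => rw [map_add]; exact Submodule.add_mem _ h h'
  | single s a =>
    simp only [retraction, Finsupp.lsum_single, LinearMap.toSpanSingleton_apply]
    split_ifs with h
    · exact Submodule.smul_mem _ _ (Submodule.smul_mem _ _
        (Submodule.subset_span ⟨⟨h.choose, h.choose_spec.1⟩, rfl⟩))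
    · simp

/-- The top cycles are spanned by the apartments containing a given flag. -/
lemma span_apartment_eq_top [FiniteDimensional F V] (hn : finrank F V = m + 1)
    (C : Fin m ↪o TitsBuilding F V) :
    Submodule.span ℤ (Set.range fun v : {v : Basis (Fin (m + 1)) F V // flagOf v = C} =>
      (⟨apartment v.1, apartment_mem_cycles v.1⟩ : cycles (TitsBuilding F V) m)) = ⊤ := by
  rw [eq_top_iff]
  intro z _
  rw [← retraction_apply_of_mem_cycles hn C z]
  exact retraction_mem_span C z.1

end Retraction

end TitsBuilding

/-! ### Coefficients of top homology classes -/

namespace OrderComplex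

variable {P Q : Type*} [PartialOrder P] [PartialOrder Q]

/-- In the top degree, homology classes are chains. -/
def homologyToChains (P : Type*) [PartialOrder P] (m : ℕ) [IsEmpty (Fin (m + 1) ↪o P)] :
    ReducedHomology P m →ₗ[ℤ] Chains P m :=
  Submodule.liftQ _ (cycles P m).subtype (by
    rintro x ⟨y, hy⟩
    rw [LinearMap.mem_ker, ← hy, Subsingleton.elim y 0, map_zero])

/-- The homology class of a cycle. -/
abbrev homologyClass (P : Type*) [PartialOrder P] (m : ℕ) : cycles P m →ₗ[ℤ] ReducedHomology P m :=
  Submodule.mkQ _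

lemma reducedHomologyMap_homologyClass (f : P ↪o Q) (m : ℕ) (z : cycles P m) :
    reducedHomologyMap f m (homologyClass P m z) = homologyClass Q m (cyclesMap f m z) := rfl

lemma chainsMap_apply_trans (f : P ↪o Q) (m : ℕ) (z : Chains P m) (s : Fin m ↪o P) :
    chainsMap f m z (s.trans f) = z s := by
  refine Finsupp.mapDomain_apply (fun s t h => ?_) z s
  ext1 i
  exact f.injective (DFunLike.congr_fun h i)

/-- The coefficient of a top homology class at a simplex. -/
def homologyCoeff (k : Type*) [CommRing k] {m : ℕ} [IsEmpty (Fin (m + 1) ↪o P)] (s : Fin m ↪o P) :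
    k ⊗[ℤ] ReducedHomology P m →ₗ[k] k :=
  open scoped Classical in
  Finsupp.lapply s ∘ₗ (TensorProduct.finsuppScalarRight ℤ k k (Fin m ↪o P)).toLinearMap ∘ₗ
    (homologyToChains P m).baseChange k

variable {k : Type*} [CommRing k] {m : ℕ}

@[simp] lemma homologyCoeff_tmul [IsEmpty (Fin (m + 1) ↪o P)] (s : Fin m ↪o P) (a : k)
    (z : cycles P m) : homologyCoeff k s (a ⊗ₜ homologyClass P m z) = z.1 s • a := by
  simp [homologyCoeff, TensorProduct.finsuppScalarRight_apply_tmul_apply, homologyToChains]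

lemma homologyCoeff_map [IsEmpty (Fin (m + 1) ↪o P)] [IsEmpty (Fin (m + 1) ↪o Q)] (f : P ↪o Q)
    (s : Fin m ↪o P) (x : k ⊗[ℤ] ReducedHomology P m) :
    homologyCoeff k (s.trans f) ((reducedHomologyMap f m).baseChange k x) =
      homologyCoeff k s x := by
  induction x with
  | zero => simp
  | add x y hx hy => simp only [map_add, hx, hy]
  | tmul a y =>
    obtain ⟨z, rfl⟩ := Submodule.mkQ_surjective _ y
    rw [LinearMap.baseChange_tmul, reducedHomologyMap_homologyClass, homologyCoeff_tmul,
      homologyCoeff_tmul]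
    exact congrArg (· • a) (chainsMap_apply_trans f m z.1 s)

/-- The map `r` gives a left inverse to `homologyToChains`, so the latter stays injective after any
base change, with no flatness of `k` over `ℤ`. -/
lemma eq_zero_of_homologyCoeff_eq_zero [IsEmpty (Fin (m + 1) ↪o P)]
    (r : Chains P m →ₗ[ℤ] cycles P m) (hr : ∀ z : cycles P m, r z.1 = z)
    {x : k ⊗[ℤ] ReducedHomology P m} (hx : ∀ s, homologyCoeff k s x = 0) : x = 0 := by
  classical
  have h1 : (homologyToChains P m).baseChange k x = 0 := by
    refine (TensorProduct.finsuppScalarRight ℤ k k (Fin m ↪o P)).injective ?_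
    rw [map_zero]
    ext s
    convert hx s
    simp only [homologyCoeff, LinearMap.comp_apply, LinearEquiv.coe_coe, Finsupp.lapply_apply]
    congr!
  have h2 : (homologyClass P m ∘ₗ r) ∘ₗ homologyToChains P m = LinearMap.id := by
    refine LinearMap.ext fun y => ?_
    obtain ⟨z, rfl⟩ := Submodule.mkQ_surjective _ y
    exact congrArg (homologyClass P m) (hr z)
  have h3 := LinearMap.congr_fun (congrArg (LinearMap.baseChange k) h2) x
  rw [LinearMap.baseChange_comp, LinearMap.comp_apply, h1, map_zero, LinearMap.baseChange_id] at h3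
  exact h3.symm

end OrderComplex

/-! ### Equivariant endomorphisms of the top homology. -/

namespace TitsBuilding

open Module OrderComplex

variable {F V : Type*} [Field F] [AddCommGroup V] [Module F V]
  {k : Type*} [CommRing k] {m : ℕ}

/-- The homology class of an apartment. -/
def apartmentClass (k : Type*) [CommRing k] (v : Basis (Fin (m + 1)) F V) :
    k ⊗[ℤ] ReducedHomology (TitsBuilding F V) m :=
  1 ⊗ₜ homologyClass _ m ⟨apartment v, apartment_mem_cycles v⟩

lemma baseChange_map_apartmentClass (g : LinearMap.GeneralLinearGroup F V)
    (v : Basis (Fin (m + 1)) F V) :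
    (reducedHomologyMap (TitsBuilding.map g) m).baseChange k (apartmentClass k v) =
      apartmentClass k (v.map (LinearMap.GeneralLinearGroup.generalLinearEquiv F V g)) := by
  rw [apartmentClass, LinearMap.baseChange_tmul, reducedHomologyMap_homologyClass]
  exact congrArg (fun z => 1 ⊗ₜ homologyClass _ m z) (Subtype.ext (chainsMap_apartment g v))

lemma linearMap_eq_of_apartmentClass [FiniteDimensional F V]
    {M : Type*} [AddCommGroup M] [Module k M]
    (hn : finrank F V = m + 1)
    (C : Fin m ↪o TitsBuilding F V) {f f' : k ⊗[ℤ] ReducedHomology (TitsBuilding F V) m →ₗ[k] M}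
    (h : ∀ v : Basis (Fin (m + 1)) F V, flagOf v = C →
      f (apartmentClass k v) = f' (apartmentClass k v)) : f = f' := by
  refine TensorProduct.AlgebraTensorModule.curry_injective (LinearMap.ext_ring ?_)
  refine LinearMap.ext fun y => ?_
  obtain ⟨z, rfl⟩ := Submodule.mkQ_surjective _ y
  have hz : z ∈ Submodule.span ℤ
      (Set.range fun v : {v : Basis (Fin (m + 1)) F V // flagOf v = C} =>
        (⟨apartment v.1, apartment_mem_cycles v.1⟩ : cycles (TitsBuilding F V) m)) :=
    span_apartment_eq_top hn C ▸ Submodule.mem_top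
  induction hz using Submodule.span_induction with
  | mem z hz =>
    obtain ⟨v, rfl⟩ := hz
    exact h v.1 v.2
  | zero => simp
  | add z z' _ _ h h' => rw [map_add, map_add, map_add, h, h']
  | smul a z _ h => rw [map_smul, map_smul, map_smul, h]

variable [IsEmpty (Fin (m + 1) ↪o TitsBuilding F V)]

@[simp] lemma homologyCoeff_apartmentClass (v : Basis (Fin (m + 1)) F V) :
    homologyCoeff k (flagOf v) (apartmentClass k v) = 1 := by
  rw [apartmentClass, homologyCoeff_tmul, apartment_apply_flagOf, one_smul]

/-- An equivariant endomorphism of the top homology of the building is multiplication by a unique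
scalar. -/
theorem existsUnique_smul_of_equivariant [FiniteDimensional F V] (hn : finrank F V = m + 1)
    (φ : k ⊗[ℤ] ReducedHomology (TitsBuilding F V) m →ₗ[k]
      k ⊗[ℤ] ReducedHomology (TitsBuilding F V) m)
    (hφ : ∀ (g : LinearMap.GeneralLinearGroup F V) x,
      φ ((reducedHomologyMap (TitsBuilding.map g) m).baseChange k x) =
        (reducedHomologyMap (TitsBuilding.map g) m).baseChange k (φ x)) :
    ∃! c : k, ∀ x, φ x = c • x := by
  let v₀ : Basis (Fin (m + 1)) F V := finBasisOfFinrankEq F V hn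
  have htrans : ∀ v : Basis (Fin (m + 1)) F V, ∃ g : LinearMap.GeneralLinearGroup F V,
      v₀.map (LinearMap.GeneralLinearGroup.generalLinearEquiv F V g) = v := by
    intro v
    refine ⟨(LinearMap.GeneralLinearGroup.generalLinearEquiv F V).symm
      (v₀.equiv v (Equiv.refl _)), ?_⟩
    rw [MulEquiv.apply_symm_apply, Basis.map_equiv]
    exact v.reindex_refl
  set c : k := homologyCoeff k (flagOf v₀) (φ (apartmentClass k v₀)) with hc
  refine ⟨c, fun x => ?_, fun d hd => ?_⟩
  -- It suffices to compare on apartments of bases `v` with the flag of `v₀`. The element `g` taking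
  -- `v₀` to `v` fixes that flag, hence preserves the coefficient there.
  · have h0 : homologyCoeff k (flagOf v₀) ∘ₗ φ = c • homologyCoeff k (flagOf v₀) := by
      refine linearMap_eq_of_apartmentClass hn (flagOf v₀) fun v hv => ?_
      obtain ⟨g, rfl⟩ := htrans v
      have hg := map_flagOf g v₀
      rw [hv] at hg
      rw [LinearMap.comp_apply, LinearMap.smul_apply, ← baseChange_map_apartmentClass, hφ]
      nth_rw 1 2 [← hg]
      rw [homologyCoeff_map, homologyCoeff_map, homologyCoeff_apartmentClass, smul_eq_mul, mul_one]
    rw [← sub_eq_zero]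
    refine eq_zero_of_homologyCoeff_eq_zero (retraction (flagOf v₀))
      (retraction_apply_of_mem_cycles hn _) fun s => ?_
    obtain ⟨v, rfl⟩ := exists_flagOf_eq hn s
    obtain ⟨g, rfl⟩ := htrans v
    obtain ⟨y, rfl⟩ : ∃ y, (reducedHomologyMap (TitsBuilding.map g) m).baseChange k y = x := by
      -- This identifies the degree with that of the Steinberg module, so the representation
      -- supplies the inverse of `g`.
      obtain rfl : m = finrank F V - 1 := by omega
      exact ⟨_, (steinbergRepBaseChange F V k).self_inv_apply g x⟩
    rw [hφ, ← map_flagOf, map_sub, map_smul, homologyCoeff_map, homologyCoeff_map, sub_eq_zero]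
    exact LinearMap.congr_fun h0 y
  · have h := congrArg (homologyCoeff k (flagOf v₀)) (hd (apartmentClass k v₀))
    rw [map_smul, homologyCoeff_apartmentClass, smul_eq_mul, mul_one] at h
    exact h.symm.trans hc.symm

end TitsBuilding

/-- A module over an algebra whose endomorphisms are uniquely scalars from a connected ring is
indecomposable. -/
theorem isIndecomposableModule_of_smul {k R M : Type*} [CommRing k] [Ring R] [AddCommGroup M]
    [Module k M] [Module R M] (hk : IsConnectedRing k) (hM : Nontrivial M)
    (h : ∀ φ : M →ₗ[R] M, ∃! c : k, ∀ x, φ x = c • x) : IsIndecomposableModule R M := by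
  refine ⟨hM, fun N N' hN => ?_⟩
  obtain ⟨c, hc, -⟩ := h (N.projection N' hN)
  -- The composite is multiplication by `c * c` and, by idempotence, also by `c`. Uniqueness of its
  -- scalar replaces faithfulness of `M` over `k`.
  obtain ⟨d, -, hd⟩ := h (N.projection N' hN ∘ₗ N.projection N' hN)
  have hidem : c * c = c := by
    rw [hd (c * c) fun x => by simp only [LinearMap.comp_apply, hc, mul_smul],
      hd c fun x => ?_]
    rw [LinearMap.comp_apply, ← hc]
    exact Submodule.projection_apply_of_mem_left hN (Submodule.projection_apply_mem hN x)
  rcases hk.2 c hidem with rfl | rfl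
  · left
    rw [Submodule.eq_bot_iff]
    intro x hx
    rw [← Submodule.projection_apply_of_mem_left hN hx, hc, zero_smul]
  · right
    rw [eq_top_iff]
    intro x _
    rw [← one_smul k x, ← hc]
    exact Submodule.projection_apply_mem hN x

end

theorem theoremB {F : Type*} [Field F] {V : Type*} [AddCommGroup V] [Module F V]
    [FiniteDimensional F V] [Nontrivial V] (k : Type*) [CommRing k] (hk : IsConnectedRing k) :
    IsIndecomposableModule k[LinearMap.GeneralLinearGroup F V] (SteinbergGLModule F V k) ∧
    ∀ φ : SteinbergGLModule F V k →ₗ[k[LinearMap.GeneralLinearGroup F V]] SteinbergGLModule F V k,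
      ∃! c : k, ∀ x : SteinbergGLModule F V k, φ x = c • x := by
  have hn : Module.finrank F V = Module.finrank F V - 1 + 1 :=
    (Nat.sub_add_cancel Module.finrank_pos).symm
  have := TitsBuilding.isEmpty_chains hn
  have hend : ∀ φ : SteinbergGLModule F V k →ₗ[k[LinearMap.GeneralLinearGroup F V]]
      SteinbergGLModule F V k, ∃! c : k, ∀ x : SteinbergGLModule F V k, φ x = c • x := by
    intro φ
    refine TitsBuilding.existsUnique_smul_of_equivariant hn (φ.restrictScalars k) fun g x => ?_
    have h1 : ∀ y : SteinbergGLModule F V k,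
        MonoidAlgebra.single g (1 : k) • y = steinbergRepBaseChange F V k g y := fun y => by
      rw [Representation.single_smul, one_smul]
      rfl
    exact (congrArg φ (h1 x)).symm.trans
      ((φ.map_smul (MonoidAlgebra.single g (1 : k)) x).trans (h1 (φ x)))
  refine ⟨isIndecomposableModule_of_smul hk ?_ hend, hend⟩
  have := hk.1
  let v : Module.Basis (Fin (Module.finrank F V - 1 + 1)) F V := Module.finBasisOfFinrankEq F V hn
  refine ⟨TitsBuilding.apartmentClass k v, (0 : k ⊗[ℤ] SteinbergModule F V), fun h => ?_⟩
  have h1 := TitsBuilding.homologyCoeff_apartmentClass (k := k) v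
  rw [h, map_zero] at h1
  exact zero_ne_one h1
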